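/- Let $\mathrm{non}(\mathcal M)$ denote the least cardinality of a nonmeager set of reals. Write $[\omega_1]^2$ for the set of pairs $(\alpha,\beta)$ with $\alpha<\beta<\omega_1$, and $[\omega_1]^n$ for the set of $n$-element subsets of $\omega_1$. For $a\in[\omega_1]^n$ and $i<n$, let $a(i)$ be the $i$-th element of $a$ in increasing order; for finite $a,b\subseteq\omega_1$, write $a<b$ if $\alpha<\beta$ for all $\alpha\in a$ and $\beta\in b$. A partition $p:[\omega_1]^2\to\omega$ is $\ell_\infty$-coherent if for all $\beta<\beta'<\omega_1$ the set of integers $\{p(\alpha,\beta)-p(\alpha,\beta')\mid\alpha<\beta\}$ is finite. For such a $p$, let $\mathrm{Pr}_0(\aleph_1,\,{}^{\aleph_0\circledast\aleph_1}/_{1\circledast\aleph_1},\,\aleph_1,\,\aleph_0)_p$ assert that there is a coloring $c:[\omega_1]^2\to\omega_1$ with the following property: for every $n<\omega$ and all pairwise disjoint families $\mathcal A,\mathcal B\subseteq[\omega_1]^n$ with $|\mathcal A|=\aleph_0$ and $|\mathcal B|=\aleph_1$, there is $a\in\mathcal A$ such that for every matrix $(\tau_{i,j})_{i,j<n}$ of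 functions from $\omega$ to $\omega_1$ there is $b\in\mathcal B$ with $a<b$ and $$c(a(i),b(j))=\tau_{i,j}\big(p(a(i),b(j))\big)\quad\text{for all } i,j<n.$$ Then $\mathrm{non}(\mathcal M)=\aleph_1$ if and only if $\mathrm{Pr}_0(\aleph_1,\,{}^{\aleph_0\circledast\aleph_1}/_{1\circledast\aleph_1},\,\aleph_1,\,\aleph_0)_p$ holds for every $\ell_\infty$-coherent partition $p:[\omega_1]^2\to\omega$. -/

import Mathlib

open scoped Ordinal Cardinal

/-- The underlying well-ordered set of the first uncountable ordinal `ω₁`. -/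
abbrev OmegaOne : Type := (ω₁ : Ordinal.{0}).ToType

/-- `[ω₁]²`, the unordered pairs of countable ordinals, each listed in increasing order. -/
abbrev OmegaOnePairs : Type := {x : OmegaOne × OmegaOne // x.1 < x.2}

/-- The value `f(α, β)` of a map `f` on `[ω₁]²` at a pair `α < β`. -/
def pairValue {Θ : Type} (f : OmegaOnePairs → Θ) {α β : OmegaOne} (h : α < β) : Θ :=
  f ⟨(α, β), h⟩

/-- `p : [ω₁]² → ω` is `ℓ_∞`-coherent: for all `β < β'`, the set of integer differences
`p(α, β) - p(α, β')`, where `α < β`, is finite. -/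
def IsLInftyCoherent (p : OmegaOnePairs → ℕ) : Prop :=
  ∀ (β β' : OmegaOne) (hβ : β < β'),
    {z : ℤ | ∃ (α : OmegaOne) (hα : α < β),
      z = ((pairValue p hα : ℕ) : ℤ) - ((pairValue p (hα.trans hβ) : ℕ) : ℤ)}.Finite

/-- `F` is a pairwise disjoint subfamily of `[ω₁]ⁿ`. -/
def IsDisjointFamily (n : ℕ) (F : Set (Finset OmegaOne)) : Prop :=
  (∀ a ∈ F, a.card = n) ∧ F.PairwiseDisjoint id

/-- The coloring `c : [ω₁]² → θ` witnesses `Pr₀(ℵ₁, ℵ₀ ⊛ ℵ₁ / 1 ⊛ ℵ₁, θ, χ)_p`.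
The element `a(i)` is `a.orderEmbOfFin _ i`, the `i`-th element of `a` in increasing order;
`a < b` means that every element of `a` is below every element of `b`. -/
def WitnessesPrZero {Θ : Type} (χ : Cardinal.{0}) (p : OmegaOnePairs → ℕ)
    (c : OmegaOnePairs → Θ) : Prop :=
  ∀ (n : ℕ) (A B : Set (Finset OmegaOne)), (n : Cardinal.{0}) < χ →
    ∀ (hA : IsDisjointFamily n A) (hB : IsDisjointFamily n B),
    #A = ℵ₀ → #B = ℵ₁ →
    ∃ (a : Finset OmegaOne) (ha : a ∈ A), ∀ τ : Fin n → Fin n → ℕ → Θ,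
      ∃ (b : Finset OmegaOne) (hb : b ∈ B) (hab : ∀ α ∈ a, ∀ β ∈ b, α < β), ∀ i j : Fin n,
        have h : a.orderEmbOfFin (hA.1 a ha) i < b.orderEmbOfFin (hB.1 b hb) j :=
          hab _ (a.orderEmbOfFin_mem _ i) _ (b.orderEmbOfFin_mem _ j)
        pairValue c h = τ i j (pairValue p h)

/-- `Pr₀(ℵ₁, ℵ₀ ⊛ ℵ₁ / 1 ⊛ ℵ₁, θ, χ)_p`: some coloring `c : [ω₁]² → θ` witnesses it. -/
def PrZero (Θ : Type) (χ : Cardinal.{0}) (p : OmegaOnePairs → ℕ) : Prop :=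
  ∃ c : OmegaOnePairs → Θ, WitnessesPrZero χ p c

/-- `non(ℳ)`, the least cardinality of a nonmeager set of reals. -/
noncomputable def nonMeager : Cardinal.{0} :=
  sInf {κ : Cardinal.{0} | ∃ X : Set ℝ, ¬ IsMeagre X ∧ #X = κ}

/-!
Both directions are combinatorial once nonmeager sets of reals are replaced by families of
functions that guess functions on `ℕ` infinitely often.

Suppose first that there is a nonmeager set of size `ℵ₁`. Reading digits of its elements gives
functions `r ξ`, for `ξ < ω₁`, one of which agrees infinitely often with any given function, even on
countably many infinite sets at once (`exists_guessing_family`). The column `c(·, β)` is built in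
stages. Stage `m` selects ordinals `ξ, δ < β` and a number `j`, and reads `r ξ m` as a finite table
of colors for finitely many ordinals below `δ`. The selections come from an independent family of
functions on `ω₁` (`exists_independent_family`), so that for any `β₀ < ... < βₙ₋₁` above `ξ` and `δ`
infinitely many stages select `(ξ, δ, j)` in the column of `βⱼ`, simultaneously for all `j`.

If every `a ∈ 𝒜` had a bad matrix `τ^a`, take `δ` above `𝒜` and above all values of these matrices.
Let `ξ` guess, at `m`, the values on a large part of `𝒜`, where `τ^a` is recorded only at arguments
up to `p(a(i), δ) + m`. Coherence bounds `p(a(i), b(j))` by `p(a(i), δ)` plus a constant depending on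
`b`, so finite tables suffice although `b` is unknown when `ξ` is chosen. The part of `𝒜` guessed at
stage `m` is disjoint and larger than the number of ordinals colored at earlier stages
(`usedBound`), so for any `b` above `ξ` and `δ` some guessed `a` is still uncolored in all the columns
of `b` and receives exactly the colors prescribed by `τ^a`: a contradiction
(`GuessingSystem.witnessesPrZero`).

Conversely, the coloring for the constant partition already yields functions `g β`, for `β < ω₁`,
that guess every function infinitely often on every infinite set
(`exists_infinitely_often_equal_family`). As in Bartoszyński's characterization of `non(ℳ)`, a
nonmeager set is obtained from pairs of these functions: partial sums of `g γ` bound the codes of a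
nested sequence of rational intervals infinitely often generously enough
(`infinite_setOf_le_partialSum_succ`), and on the infinite set of such places `g β` guesses
intervals inside given dense open sets (`nonMeager_eq_aleph_one_of_family`).
-/

/-! ### Countable ordinals and nonmeager sets of reals -/

theorem mk_omegaOne : #OmegaOne = ℵ₁ := by
  simp [OmegaOne]

instance : Uncountable OmegaOne := by
  rw [← Cardinal.aleph0_lt_mk_iff, mk_omegaOne]
  exact Cardinal.aleph0_lt_aleph_one

theorem countable_Iio_omegaOne (δ : OmegaOne) : (Set.Iio δ).Countable := by
  have h := Cardinal.mk_Iio_lt δ (by rw [mk_omegaOne]; simp [OmegaOne])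
  rwa [mk_omegaOne, ← Cardinal.succ_aleph0, Order.lt_succ_iff,
    Cardinal.le_aleph0_iff_set_countable] at h

theorem countable_Iic_omegaOne (δ : OmegaOne) : (Set.Iic δ).Countable := by
  rw [← Set.Iio_insert]
  exact (countable_Iio_omegaOne δ).insert δ

theorem exists_gt_of_countable {s : Set OmegaOne} (hs : s.Countable) : ∃ δ, ∀ α ∈ s, α < δ := by
  by_contra! h
  refine not_countable (α := OmegaOne) (Set.countable_univ_iff.1 ?_)
  refine (hs.biUnion fun α _ => countable_Iic_omegaOne α).mono fun δ _ => ?_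
  obtain ⟨α, hα, hle⟩ := h δ
  exact Set.mem_biUnion hα hle

/-- Simultaneous enumerations of the proper initial segments of `ω₁`: `idx δ` numbers the
elements below `δ`, and `e δ` decodes the numbers. -/
theorem exists_enumerations : ∃ (idx : OmegaOne → OmegaOne → ℕ) (e : OmegaOne → ℕ → OmegaOne),
    ∀ α δ, α < δ → e δ (idx δ α) = α := by
  classical
  have h : ∀ δ : OmegaOne, ∃ (i : OmegaOne → ℕ) (e : ℕ → OmegaOne), ∀ α < δ, e (i α) = α := by
    intro δ
    obtain ⟨i, hi⟩ := (Set.countable_iff_exists_injOn.1 (countable_Iio_omegaOne δ))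
    have : Nonempty OmegaOne := ⟨δ⟩
    exact ⟨i, Function.invFunOn i (Set.Iio δ), fun α hα => hi.leftInvOn_invFunOn hα⟩
  choose idx e h using h
  exact ⟨idx, e, fun α δ => h δ α⟩

theorem isMeagre_of_countable {X : Set ℝ} (hX : X.Countable) : IsMeagre X := by
  have : ∀ᶠ y in residual ℝ, ∀ x ∈ X, y ≠ x := by
    rw [eventually_countable_ball hX]
    exact fun x _ => residual_of_dense_open isOpen_compl_singleton (dense_compl_singleton x)
  exact Filter.mem_of_superset this fun y hy hyX => hy y hyX rfl

theorem nonMeager_eq_aleph_one_iff :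
    nonMeager = ℵ₁ ↔ ∃ X : Set ℝ, ¬ IsMeagre X ∧ #X ≤ ℵ₁ := by
  have hlow : ∀ X : Set ℝ, ¬ IsMeagre X → ℵ₁ ≤ #X := by
    intro X hX
    rw [← Cardinal.succ_aleph0, Order.succ_le_iff]
    by_contra! hle
    exact hX (isMeagre_of_countable (Cardinal.le_aleph0_iff_set_countable.1 hle))
  constructor
  · intro h
    have hne : {κ : Cardinal.{0} | ∃ X : Set ℝ, ¬ IsMeagre X ∧ #X = κ}.Nonempty :=
      ⟨_, Set.univ, not_isMeagre_of_isOpen isOpen_univ Set.univ_nonempty, rfl⟩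
    obtain ⟨X, hX, hc⟩ := csInf_mem hne
    exact ⟨X, hX, (hc.trans h).le⟩
  · rintro ⟨X, hX, hc⟩
    apply le_antisymm
    · exact le_trans (csInf_le' (by exact ⟨X, hX, rfl⟩)) hc
    · refine le_csInf ⟨_, X, hX, rfl⟩ ?_
      rintro κ ⟨Y, hY, rfl⟩
      exact hlow Y hY

/-! ### A family of `ℵ₁` guessing functions from a nonmeager set of size `ℵ₁` -/

/-- The `m`-th digit of a real `x`: the number `v` such that the fractional part of `m * x`
lies in `(1 / (v + 2), 1 / (v + 1)]`, or `0` if `m * x` is an integer. For large `m`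
all digits occur in any given interval. -/
noncomputable def realDigit (x : ℝ) (m : ℕ) : ℕ := ⌊(Int.fract (m * x))⁻¹⌋₊ - 1

theorem realDigit_eq {x : ℝ} {m v : ℕ} {z : ℤ} (h₁ : z + (1 / (v + 2) : ℝ) < m * x)
    (h₂ : m * x < z + (1 / (v + 1) : ℝ)) : realDigit x m = v := by
  have hv2 : (0 : ℝ) < 1 / (v + 2) := by positivity
  have hv1 : (1 / (v + 1) : ℝ) ≤ 1 := by
    rw [div_le_one (by positivity)]
    linarith [(Nat.cast_nonneg v : (0 : ℝ) ≤ v)]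
  have hfl : ⌊(m * x : ℝ)⌋ = z := Int.floor_eq_iff.2 ⟨by linarith, by linarith⟩
  have hfr : Int.fract (m * x : ℝ) = m * x - z := by rw [Int.fract, hfl]
  have hpos : (0 : ℝ) < m * x - z := by linarith
  have h1 : (v + 1 : ℝ) ≤ (m * x - z)⁻¹ := by
    rw [le_inv_comm₀ (by positivity) hpos, ← one_div]
    linarith
  have h2 : (m * x - z : ℝ)⁻¹ < v + 2 := by
    rw [inv_lt_comm₀ hpos (by positivity), ← one_div]
    linarith
  have : ⌊(m * x - z : ℝ)⁻¹⌋₊ = v + 1 := by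
    rw [Nat.floor_eq_iff (by positivity)]
    push_cast
    exact ⟨h1, by linarith⟩
  rw [realDigit, hfr, this, Nat.add_sub_cancel]

/-- A comeager set of reals guesses a given function on a given infinite set. -/
theorem eventually_residual_exists_realDigit_eq {M : Set ℕ} (hM : M.Infinite) (H : ℕ → ℕ) :
    ∀ᶠ x in residual ℝ, ∃ m ∈ M, realDigit x m = H m := by
  let W : Set ℝ := ⋃ m ∈ M, ⋃ z : ℤ,
    {x : ℝ | z + (1 / (H m + 2) : ℝ) < m * x} ∩ {x : ℝ | m * x < z + (1 / (H m + 1) : ℝ)}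
  have hWo : IsOpen W := by
    refine isOpen_biUnion fun m _ => isOpen_iUnion fun z => IsOpen.inter ?_ ?_
    · exact isOpen_lt (by fun_prop) (by fun_prop)
    · exact isOpen_lt (by fun_prop) (by fun_prop)
  have hWd : Dense W := by
    rw [Metric.dense_iff]
    intro x ε hε
    obtain ⟨N, hN⟩ := exists_nat_gt (1 / ε)
    obtain ⟨m, hmM, hNm⟩ := hM.exists_gt N
    have hm : (1 / ε : ℝ) < m := hN.trans (by exact_mod_cast hNm)
    have hm0 : (0 : ℝ) < m := (by positivity : (0 : ℝ) < 1 / ε).trans hm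
    have hlt : (1 / (H m + 2) : ℝ) < 1 / (H m + 1) :=
      one_div_lt_one_div_of_lt (by positivity) (by linarith)
    obtain ⟨y, hy1, hy2⟩ := exists_between hlt
    have hy0 : 0 < y := lt_trans (by positivity) hy1
    have hyl : y < 1 := hy2.trans_le (by
      rw [div_le_one (by positivity)]
      linarith [(Nat.cast_nonneg (H m) : (0 : ℝ) ≤ H m)])
    have hmul : (m : ℝ) * ((⌊(m * x : ℝ)⌋ + y) / m) = ⌊(m * x : ℝ)⌋ + y := by field_simp
    refine ⟨(⌊(m * x : ℝ)⌋ + y) / m, ?_, ?_⟩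
    · have hf1 := Int.floor_le (m * x : ℝ)
      have hf2 := Int.lt_floor_add_one (m * x : ℝ)
      rw [Metric.mem_ball, Real.dist_eq]
      have : ((⌊(m * x : ℝ)⌋ + y) / m - x : ℝ) = (⌊(m * x : ℝ)⌋ + y - m * x) / m := by
        field_simp
      rw [this, abs_div, abs_of_pos hm0, div_lt_iff₀ hm0]
      rw [div_lt_iff₀ hε] at hm
      rw [abs_lt]
      constructor <;> nlinarith
    · simp only [W, Set.mem_iUnion]
      refine ⟨m, hmM, ⌊(m * x : ℝ)⌋, ?_, ?_⟩
      · rw [Set.mem_ofPred_eq, hmul]; linarith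
      · rw [Set.mem_ofPred_eq, hmul]; linarith
  filter_upwards [residual_of_dense_open hWo hWd] with x hx
  simp only [W, Set.mem_iUnion] at hx
  obtain ⟨m, hm, z, h1, h2⟩ := hx
  exact ⟨m, hm, realDigit_eq h1 h2⟩

theorem exists_guessing_family (h : nonMeager = ℵ₁) (M : ℕ → Set ℕ)
    (hM : ∀ t, (M t).Infinite) :
    ∃ r : OmegaOne → ℕ → ℕ, ∀ H : ℕ → ℕ, ∃ ξ, ∀ t N, ∃ m ∈ M t, N ≤ m ∧ r ξ m = H m := by
  obtain ⟨X, hX, hc⟩ := nonMeager_eq_aleph_one_iff.1 h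
  have hne : X.Nonempty := by
    rw [Set.nonempty_iff_ne_empty]
    rintro rfl
    exact hX IsMeagre.empty
  have : Nonempty X := hne.to_subtype
  rw [← mk_omegaOne] at hc
  obtain ⟨f⟩ := hc
  refine ⟨fun ξ => realDigit (Function.invFun f ξ : X), fun H => ?_⟩
  have hev : ∀ᶠ x in residual ℝ, ∀ t N, ∃ m ∈ M t ∩ Set.Ici N, realDigit x m = H m := by
    rw [eventually_countable_forall]
    intro t
    rw [eventually_countable_forall]
    intro N
    refine eventually_residual_exists_realDigit_eq ?_ H
    have := (hM t).sdiff (Set.finite_lt_nat N)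
    refine this.mono ?_
    rintro m ⟨h1, h2⟩
    exact ⟨h1, Set.mem_Ici.2 (not_lt.1 h2)⟩
  obtain ⟨x, hx, hxX⟩ : ∃ x, (∀ t N, ∃ m ∈ M t ∩ Set.Ici N, realDigit x m = H m) ∧ x ∈ X := by
    by_contra! hno
    exact hX (Filter.mem_of_superset hev fun x hx => hno x hx)
  refine ⟨f ⟨x, hxX⟩, fun t N => ?_⟩
  obtain ⟨m, ⟨h1, h2⟩, h3⟩ := hx t N
  refine ⟨m, h1, h2, ?_⟩
  simpa only [Function.leftInverse_invFun f.injective _] using h3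

/-! ### Independent functions on `ω₁` -/

theorem exists_finsupp_eq_on {X Y : Type*} [Zero Y] (f : X → Y) (F : Finset X) :
    ∃ ψ : X →₀ Y, ∀ x ∈ F, ψ x = f x := by
  classical
  refine ⟨Finsupp.onFinset F (fun x => if x ∈ F then f x else 0) (by simp +contextual), ?_⟩
  intro x hx
  simp [hx]

/-- There are `ℵ₁` functions on `ℕ` such that any finitely many of them take any prescribed
values simultaneously, on one of countably many infinite sets fixed in advance. -/
theorem exists_independent_family (V : Type) [Countable V] [Zero V] :
    ∃ (D : OmegaOne → ℕ → V) (M : ℕ → Set ℕ), (∀ t, (M t).Infinite) ∧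
      ∀ (n : ℕ) (b : Fin n → OmegaOne) (v : Fin n → V), Function.Injective b →
        ∃ t, ∀ m ∈ M t, ∀ j, D (b j) m = v j := by
  classical
  obtain ⟨x⟩ : Nonempty (OmegaOne ↪ (ℕ → Bool)) := by
    rw [← Cardinal.le_def, mk_omegaOne]
    simpa using Cardinal.aleph_one_le_continuum
  obtain ⟨f, hf⟩ := exists_surjective_nat (ℕ × (List Bool →₀ V))
  let tr : OmegaOne → ℕ → List Bool := fun β l => (List.range l).map (x β)
  refine ⟨fun β m => (f m.unpair.1).2 (tr β (f m.unpair.1).1), fun t => {m | m.unpair.1 = t},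
    fun t => ?_, fun n b v hb => ?_⟩
  · refine Set.infinite_of_injective_forall_mem (f := fun k => Nat.pair t k) ?_ ?_
    · intro k k' h
      simpa using h
    · intro k
      simp
  · have hsep : ∀ j j', ∃ l, b j ≠ b j' → x (b j) l ≠ x (b j') l := by
      intro j j'
      by_cases h : b j = b j'
      · exact ⟨0, fun h' => absurd h h'⟩
      · obtain ⟨l, hl⟩ := Function.ne_iff.1 (x.injective.ne h)
        exact ⟨l, fun _ => hl⟩
    choose l hl using hsep
    obtain ⟨L, hL⟩ : ∃ L, ∀ j j', l j j' < L := by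
      refine ⟨(Finset.univ.sup fun q : Fin n × Fin n => l q.1 q.2) + 1, fun j j' => ?_⟩
      exact Nat.lt_succ_of_le
        (Finset.le_sup (f := fun q : Fin n × Fin n => l q.1 q.2) (Finset.mem_univ (j, j')))
    have hinj : Function.Injective fun j => tr (b j) L := by
      intro j j' h
      by_contra hne
      refine hl j j' (hb.ne hne) ?_
      exact (List.map_inj_left.1 h) _ (List.mem_range.2 (hL j j'))
    obtain ⟨ψ, hψ⟩ := exists_finsupp_eq_on
      (fun s => if h : ∃ j, tr (b j) L = s then v h.choose else 0)
      (Finset.univ.image fun j => tr (b j) L)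
    obtain ⟨t, ht⟩ := hf (L, ψ)
    refine ⟨t, fun m hm j => ?_⟩
    have hm' : m.unpair.1 = t := hm
    have hex : ∃ j', tr (b j') L = tr (b j) L := ⟨j, rfl⟩
    simp only [hm', ht]
    rw [hψ _ (Finset.mem_image_of_mem _ (Finset.mem_univ j)), dif_pos hex,
      hinj hex.choose_spec]

/-! ### The coloring built from guesses -/

theorem Finset.card_le_card_of_pairwiseDisjoint_of_forall_inter {ι X : Type*} [DecidableEq X]
    {I : Finset ι} {f : ι → Finset X} (hd : ∀ i ∈ I, ∀ j ∈ I, ∀ x, x ∈ f i → x ∈ f j → i = j)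
    {U : Finset X} (h : ∀ i ∈ I, ∃ x ∈ f i, x ∈ U) : I.card ≤ U.card := by
  rcases I.eq_empty_or_nonempty with rfl | ⟨i₀, hi₀⟩
  · simp
  have : Nonempty X := ⟨(h i₀ hi₀).choose⟩
  choose! g hg hgU using h
  refine Finset.card_le_card_of_injOn g hgU fun i hi j hj hij => ?_
  exact hd i hi j hj (g i) (hg i hi) (hij ▸ hg j hj)

theorem exists_mem_forall_gt_of_uncountable {B : Set (Finset OmegaOne)}
    (hB : B.PairwiseDisjoint id) (hc : ¬ B.Countable) (γ : OmegaOne) :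
    ∃ b ∈ B, ∀ β ∈ b, γ < β := by
  by_contra! h
  choose! g hg hgγ using h
  refine hc (Set.MapsTo.countable_of_injOn (f := g) (t := Set.Iic γ) (fun b hb => hgγ b hb) ?_
    (countable_Iic_omegaOne γ))
  intro b hb b' hb' heq
  exact hB.elim_finset hb hb' (g b) (hg b hb) (heq ▸ hg b' hb')

theorem IsLInftyCoherent.exists_bound {p : OmegaOnePairs → ℕ} (hp : IsLInftyCoherent p)
    {δ β : OmegaOne} (h : δ < β) :
    ∃ N, ∀ (α : OmegaOne) (hα : α < δ), pairValue p (hα.trans h) ≤ pairValue p hα + N := by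
  obtain ⟨z, hz⟩ := (hp δ β h).bddBelow
  refine ⟨z.natAbs, fun α hα => ?_⟩
  have := hz ⟨α, hα, rfl⟩
  omega

/-- A bound for the number of ordinals `α` that are colored before stage `m`. Stage `m` may
color `m * (m * usedBound m + 1)` ordinals, which leaves room for a disjoint family of
`m * usedBound m + 1` sets of size at most `m`: more sets than the earlier stages of `m`
different columns can meet. -/
def usedBound : ℕ → ℕ
  | 0 => 0
  | m + 1 => usedBound m + m * (m * usedBound m + 1)

/-- The data from which the coloring is built. The maps `idx δ` and `e δ` number the ordinals
below `δ`; `r` is a family of guessing functions whose values are decoded by `dec` as a finite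
set of indices of ordinals together with a finite table of indices of colors; the value
`D β m = (u, w, j)` says that stage `m` of the column `β` uses the guessing function
`r (e β u)`, the numbering of the ordinals below `e β w`, and the row block `j` of the table. -/
structure GuessingSystem where
  idx : OmegaOne → OmegaOne → ℕ
  e : OmegaOne → ℕ → OmegaOne
  e_idx : ∀ α δ, α < δ → e δ (idx δ α) = α
  r : OmegaOne → ℕ → ℕ
  dec : ℕ → Finset ℕ × (ℕ × ℕ × ℕ →₀ ℕ)
  dec_surjective : Function.Surjective dec
  D : OmegaOne → ℕ → ℕ × ℕ × ℕ

namespace GuessingSystem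

variable (S : GuessingSystem)

/-- The ordinal whose numbering is used at stage `m` of the column `β`. -/
def delta (β : OmegaOne) (m : ℕ) : OmegaOne := S.e β (S.D β m).2.1

/-- The guess used at stage `m` of the column `β`. -/
def guess (β : OmegaOne) (m : ℕ) : Finset ℕ × (ℕ × ℕ × ℕ →₀ ℕ) :=
  S.dec (S.r (S.e β (S.D β m).1) m)

/-- Stage `m` of the column `β` offers a color for `α`. Guesses with too large a domain are
ignored. -/
def Hits (α β : OmegaOne) (m : ℕ) : Prop :=
  α < S.delta β m ∧ S.idx (S.delta β m) α ∈ (S.guess β m).1 ∧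
    (S.guess β m).1.card ≤ m * (m * usedBound m + 1)

open Classical in
/-- The color of `(α, β)` is the one offered by the first stage of the column `β` that offers a
color for `α`. -/
noncomputable def color (p : OmegaOnePairs → ℕ) (x : OmegaOnePairs) : OmegaOne :=
  if h : ∃ m, S.Hits x.1.1 x.1.2 m then
    S.e (S.delta x.1.2 (Nat.find h)) ((S.guess x.1.2 (Nat.find h)).2
      (S.idx (S.delta x.1.2 (Nat.find h)) x.1.1, (S.D x.1.2 (Nat.find h)).2.2, p x))
  else x.1.1

variable {S}

theorem idx_injOn {α α' δ : OmegaOne} (h : α < δ) (h' : α' < δ)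
    (heq : S.idx δ α = S.idx δ α') : α = α' := by
  rw [← S.e_idx α δ h, heq, S.e_idx α' δ h']

theorem color_eq {p : OmegaOnePairs → ℕ} {α β : OmegaOne} (h : α < β) {m : ℕ}
    (hm : S.Hits α β m) (hlt : ∀ k < m, ¬ S.Hits α β k) :
    pairValue (S.color p) h = S.e (S.delta β m)
      ((S.guess β m).2 (S.idx (S.delta β m) α, (S.D β m).2.2, pairValue p h)) := by
  classical
  have hex : ∃ m, S.Hits α β m := ⟨m, hm⟩
  have hfind : Nat.find hex = m := (Nat.find_eq_iff hex).2 ⟨hm, hlt⟩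
  unfold pairValue color
  rw [dif_pos hex]
  simp only [hfind]

theorem card_le_usedBound (β : OmegaOne) (m : ℕ) (F : Finset OmegaOne)
    (hF : ∀ α ∈ F, ∃ k < m, S.Hits α β k) : F.card ≤ usedBound m := by
  classical
  induction m generalizing F with
  | zero =>
    have : F = ∅ := Finset.eq_empty_of_forall_notMem fun α hα => by simpa using hF α hα
    simp [this]
  | succ m ih =>
    rw [← Finset.card_filter_add_card_filter_not (s := F) (fun α => ∃ k < m, S.Hits α β k)]
    refine Nat.add_le_add (ih _ fun α hα => (Finset.mem_filter.1 hα).2) ?_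
    have hit : ∀ α ∈ F.filter (fun α => ¬ ∃ k < m, S.Hits α β k), S.Hits α β m := by
      intro α hα
      obtain ⟨hα, hno⟩ := Finset.mem_filter.1 hα
      obtain ⟨k, hk, hh⟩ := hF α hα
      rcases (Nat.lt_succ_iff_lt_or_eq.1 hk) with hk | rfl
      · exact absurd ⟨k, hk, hh⟩ hno
      · exact hh
    rcases (F.filter (fun α => ¬ ∃ k < m, S.Hits α β k)).eq_empty_or_nonempty with h0 | ⟨α, hα⟩
    · rw [h0]; simp
    · refine le_trans (Finset.card_le_card_of_injOn (S.idx (S.delta β m))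
        (fun α hα => (hit α hα).2.1) ?_) (hit α hα).2.2
      intro α hα α' hα' heq
      exact idx_injOn (hit α hα).1 (hit α' hα').1 heq

/-- The coloring has the required property as soon as the functions `S.D` are independent along
the sets `M t` and the functions `S.r` guess along these sets. -/
theorem witnessesPrZero (M : ℕ → Set ℕ)
    (hD : ∀ (n : ℕ) (b : Fin n → OmegaOne) (v : Fin n → ℕ × ℕ × ℕ), Function.Injective b →
      ∃ t, ∀ m ∈ M t, ∀ j, S.D (b j) m = v j)
    (hr : ∀ H : ℕ → ℕ, ∃ ξ, ∀ t N, ∃ m ∈ M t, N ≤ m ∧ S.r ξ m = H m)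
    {p : OmegaOnePairs → ℕ} (hp : IsLInftyCoherent p) :
    WitnessesPrZero ℵ₀ p (S.color p) := by
  classical
  intro n A B _ hA hB hAc hBc
  by_contra! hbad
  choose τ hτ using hbad
  have hAcount : Countable A := by
    rw [← Cardinal.mk_le_aleph0_iff, hAc]
  have hAinf : Infinite A := by
    rw [Cardinal.infinite_iff, hAc]
  -- `el a i` is the `i`-th element of `a`
  let el : A → Fin n → OmegaOne := fun a i => a.1.orderEmbOfFin (hA.1 a.1 a.2) i
  have hel : ∀ (a : A) (x), x ∈ a.1 → ∃ i, el a i = x := by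
    intro a x hx
    have : x ∈ Set.range (a.1.orderEmbOfFin (hA.1 a.1 a.2)) := by
      rw [Finset.range_orderEmbOfFin]; exact hx
    exact this
  have hdisj : ∀ (a a' : A) (x), x ∈ a.1 → x ∈ a'.1 → a = a' := fun a a' x hx hx' =>
    Subtype.ext (hA.2.elim_finset a.2 a'.2 x hx hx')
  have hel_mem : ∀ a i, el a i ∈ a.1 := fun a i => Finset.orderEmbOfFin_mem _ _ i
  -- all ordinals in question lie below some `δ`
  obtain ⟨δ, hδ⟩ := exists_gt_of_countable
    ((Set.countable_range (fun q : A × Fin n => el q.1 q.2)).union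
      (Set.countable_range (fun q : A × Fin n × Fin n × ℕ => τ q.1.1 q.1.2 q.2.1 q.2.2.1 q.2.2.2)))
  have hδel : ∀ a i, el a i < δ := fun a i => hδ _ (Or.inl ⟨(a, i), rfl⟩)
  have hδτ : ∀ (a : A) i j k, τ a.1 a.2 i j k < δ := fun a i j k => hδ _ (Or.inr ⟨(a, i, j, k), rfl⟩)
  -- the complete table of colors to be guessed
  obtain ⟨Ψ, hΨ⟩ : ∃ Ψ : ℕ × ℕ × ℕ → ℕ, ∀ (a : A) (i j : Fin n) (k : ℕ),
      Ψ (S.idx δ (el a i), j, k) = S.idx δ (τ a.1 a.2 i j k) := by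
    let q : A × Fin n × Fin n × ℕ → ℕ × ℕ × ℕ :=
      fun y => (S.idx δ (el y.1 y.2.1), y.2.2.1, y.2.2.2)
    have hq : Function.Injective q := by
      rintro ⟨a, i, j, k⟩ ⟨a', i', j', k'⟩ h
      simp only [q, Prod.mk.injEq] at h
      obtain ⟨h1, h2, h3⟩ := h
      have h1 := idx_injOn (hδel a i) (hδel a' i') h1
      obtain rfl : a = a' := hdisj a a' _ (hel_mem a i) (h1 ▸ hel_mem a' i')
      obtain rfl : i = i' := (a.1.orderEmbOfFin (hA.1 a.1 a.2)).injective h1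
      obtain rfl : j = j' := Fin.ext h2
      rw [h3]
    refine ⟨Function.extend q (fun y => S.idx δ (τ y.1.1 y.1.2 y.2.1 y.2.2.1 y.2.2.2)) 0, ?_⟩
    intro a i j k
    exact hq.extend_apply _ _ (a, i, j, k)
  -- the correct guess at `m`: a large part of `A` with the values on a finite window
  choose Am hAm using fun m : ℕ => Infinite.exists_subset_card_eq A (m * usedBound m + 1)
  let s : ℕ → Finset ℕ := fun m => (Am m).biUnion fun a => a.1.image (S.idx δ)
  have hs : ∀ m, (s m).card ≤ (m * usedBound m + 1) * n := by
    intro m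
    rw [← hAm m]
    refine Finset.card_biUnion_le_card_mul _ _ _ fun a _ => ?_
    exact Finset.card_image_le.trans (hA.1 a.1 a.2).le
  choose ψ hψ using fun m : ℕ => exists_finsupp_eq_on Ψ
    ((Am m).biUnion fun a => Finset.univ.biUnion fun i => Finset.univ.biUnion fun j : Fin n =>
      (Finset.range (pairValue p (hδel a i) + m + 1)).image fun k =>
        (S.idx δ (el a i), (j : ℕ), k))
  choose H hH using fun m : ℕ => S.dec_surjective (s m, ψ m)
  obtain ⟨ξ, hξ⟩ := hr H
  -- a column block above everything
  have hBunc : ¬ B.Countable := by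
    rw [← Cardinal.le_aleph0_iff_set_countable, hBc, not_le]
    exact Cardinal.aleph0_lt_aleph_one
  obtain ⟨b, hb, hgt⟩ := exists_mem_forall_gt_of_uncountable hB.2 hBunc (max ξ δ)
  let bl : Fin n → OmegaOne := fun j => b.orderEmbOfFin (hB.1 b hb) j
  have hblmem : ∀ j, bl j ∈ b := fun j => Finset.orderEmbOfFin_mem _ _ j
  have hξb : ∀ j, ξ < bl j := fun j => (le_max_left _ _).trans_lt (hgt _ (hblmem j))
  have hδb : ∀ j, δ < bl j := fun j => (le_max_right _ _).trans_lt (hgt _ (hblmem j))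
  have hab : ∀ a ∈ A, ∀ α ∈ a, ∀ β ∈ b, α < β := by
    intro a ha α hα β hβ
    obtain ⟨i, hi⟩ := hel ⟨a, ha⟩ α hα
    exact (hi ▸ hδel ⟨a, ha⟩ i).trans ((le_max_right _ _).trans_lt (hgt β hβ))
  obtain ⟨t, ht⟩ := hD n bl (fun j => (S.idx (bl j) ξ, S.idx (bl j) δ, j))
    (b.orderEmbOfFin (hB.1 b hb)).injective
  choose N hN using fun j => hp.exists_bound (hδb j)
  obtain ⟨m, hmM, hNm, hm⟩ := hξ t (max n (Finset.univ.sup N))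
  have hnm : n ≤ m := (le_max_left _ _).trans hNm
  have hNm' : ∀ j, N j ≤ m := fun j =>
    (Finset.le_sup (Finset.mem_univ j)).trans ((le_max_right _ _).trans hNm)
  have hDm : ∀ j, S.D (bl j) m = (S.idx (bl j) ξ, S.idx (bl j) δ, (j : ℕ)) := ht m hmM
  have hdelta : ∀ j, S.delta (bl j) m = δ := fun j => by
    rw [delta, hDm]; exact S.e_idx _ _ (hδb j)
  have hguess : ∀ j, S.guess (bl j) m = (s m, ψ m) := fun j => by
    rw [guess, hDm]; simp only [S.e_idx _ _ (hξb j), hm, hH]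
  -- some `a` in the guess is untouched by the earlier stages of all the columns in `b`
  obtain ⟨a, ham, hfree⟩ : ∃ a ∈ Am m, ∀ i j, ∀ k < m, ¬ S.Hits (el a i) (bl j) k := by
    by_contra! hno
    let F : Fin n → Finset OmegaOne := fun j =>
      ((Am m).biUnion fun a => a.1).filter fun α => ∃ k < m, S.Hits α (bl j) k
    have h1 : (Am m).card ≤ (Finset.univ.biUnion F).card := by
      refine Finset.card_le_card_of_pairwiseDisjoint_of_forall_inter (f := fun a : A => a.1)
        (fun a _ a' _ x hx hx' => hdisj a a' x hx hx') fun a ha => ?_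
      obtain ⟨i, j, k, hk, hh⟩ := hno a ha
      refine ⟨el a i, hel_mem a i, Finset.mem_biUnion.2 ⟨j, Finset.mem_univ j, ?_⟩⟩
      exact Finset.mem_filter.2 ⟨Finset.mem_biUnion.2 ⟨a, ha, hel_mem a i⟩, k, hk, hh⟩
    have h2 : (Finset.univ.biUnion F).card ≤ n * usedBound m := by
      have := Finset.card_biUnion_le_card_mul Finset.univ F (usedBound m) fun j _ =>
        card_le_usedBound (bl j) m _ fun α hα => (Finset.mem_filter.1 hα).2
      simpa using this
    have h3 : n * usedBound m ≤ m * usedBound m := Nat.mul_le_mul_right _ hnm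
    have h4 := hAm m
    omega
  obtain ⟨i, j, hne⟩ := hτ a.1 a.2 b hb (hab a.1 a.2)
  refine hne ?_
  have hlt : el a i < bl j := hab a.1 a.2 _ (hel_mem a i) _ (hblmem j)
  have hhit : S.Hits (el a i) (bl j) m := by
    refine ⟨by rw [hdelta]; exact hδel a i, ?_, ?_⟩
    · rw [hdelta, hguess]
      exact Finset.mem_biUnion.2 ⟨a, ham, Finset.mem_image_of_mem _ (hel_mem a i)⟩
    · rw [hguess]
      refine (hs m).trans ?_
      rw [mul_comm]
      exact Nat.mul_le_mul_right _ hnm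
  have hwin : pairValue p hlt < pairValue p (hδel a i) + m + 1 := by
    have h1 := hN j (el a i) (hδel a i)
    have h2 := hNm' j
    omega
  have hcol := color_eq (p := p) hlt hhit (hfree i j)
  rw [hdelta, hguess, hDm] at hcol
  rw [hψ m _ ?_, hΨ a i j, S.e_idx _ _ (hδτ a i j _)] at hcol
  · exact hcol
  · simp only [Finset.mem_biUnion, Finset.mem_image, Finset.mem_range, Finset.mem_univ, true_and]
    exact ⟨a, ham, i, j, _, hwin, rfl⟩

end GuessingSystem

theorem prZero_of_nonMeager_eq_aleph_one (h : nonMeager = ℵ₁) {p : OmegaOnePairs → ℕ}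
    (hp : IsLInftyCoherent p) : PrZero OmegaOne ℵ₀ p := by
  obtain ⟨idx, e, he⟩ := exists_enumerations
  obtain ⟨D, M, hM, hD⟩ := exists_independent_family (ℕ × ℕ × ℕ)
  obtain ⟨r, hr⟩ := exists_guessing_family h M hM
  obtain ⟨dec, hdec⟩ := exists_surjective_nat (Finset ℕ × (ℕ × ℕ × ℕ →₀ ℕ))
  exact ⟨_, GuessingSystem.witnessesPrZero (S := ⟨idx, e, he, r, dec, hdec, D⟩) M hD hr hp⟩

/-! ### A nonmeager set of size `ℵ₁` from the coloring -/

/-- Even for the constant partition and for singletons, the coloring property yields `ℵ₁`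
functions that guess every function infinitely often on every infinite set. -/
theorem exists_infinitely_often_equal_family
    (h : PrZero OmegaOne ℵ₀ (fun _ => 0)) :
    ∃ g : OmegaOne → ℕ → ℕ, ∀ (A : Set ℕ) (f : ℕ → ℕ), A.Infinite →
      ∃ β, {k ∈ A | g β k = f k}.Infinite := by
  classical
  obtain ⟨c, hc⟩ := h
  let o : ℕ ↪ OmegaOne := Infinite.natEmbedding OmegaOne
  let dec : OmegaOne → ℕ := Function.invFun o
  have hdec : ∀ k, dec (o k) = k := Function.leftInverse_invFun o.injective
  refine ⟨fun β k => if hk : o k < β then dec (pairValue c hk) else 0, fun A f hA => ?_⟩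
  set g : OmegaOne → ℕ → ℕ := fun β k => if hk : o k < β then dec (pairValue c hk) else 0 with hg
  by_contra! hfin
  have hbound : ∀ β, ∃ N, ∀ k ∈ A, N ≤ k → g β k ≠ f k := by
    intro β
    obtain ⟨N, hN⟩ := (hfin β).bddAbove
    refine ⟨N + 1, fun k hk hle heq => ?_⟩
    have : k ≤ N := hN ⟨hk, heq⟩
    omega
  choose N hN using hbound
  obtain ⟨N₀, hN₀⟩ := Cardinal.exists_uncountable_fiber N (by
    rw [Cardinal.mk_nat, mk_omegaOne]; exact Cardinal.aleph0_lt_aleph_one)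
  have hsing : ∀ T : Set OmegaOne, IsDisjointFamily 1 ((fun x => ({x} : Finset OmegaOne)) '' T) := by
    intro T
    constructor
    · rintro _ ⟨x, _, rfl⟩
      simp
    · rintro _ ⟨x, _, rfl⟩ _ ⟨y, _, rfl⟩ hne
      have hxy : x ≠ y := fun h => hne (by rw [h])
      exact Finset.disjoint_singleton.2 hxy
  have hinj : Function.Injective (fun x => ({x} : Finset OmegaOne)) := Finset.singleton_injective
  -- discarding the numbers below `N₀` from `A` makes `g β` avoid `f` throughout for all these `β`
  have hA' : (A \ {k | k < N₀}).Infinite := hA.sdiff (Set.finite_lt_nat N₀)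
  obtain ⟨a, ha, hτ⟩ := hc 1
    ((fun x => ({x} : Finset OmegaOne)) '' (o '' (A \ {k | k < N₀})))
    ((fun x => ({x} : Finset OmegaOne)) '' (N ⁻¹' {N₀}))
    (by exact_mod_cast Cardinal.natCast_lt_aleph0 (n := 1)) (hsing _) (hsing _)
    (by
      rw [Cardinal.mk_image_eq hinj, Cardinal.mk_image_eq o.injective]
      have := hA'.to_subtype
      exact Cardinal.mk_eq_aleph0 _)
    (by
      rw [Cardinal.mk_image_eq hinj]
      refine le_antisymm ((Cardinal.mk_set_le _).trans mk_omegaOne.le) ?_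
      rw [← Cardinal.succ_aleph0, Order.succ_le_iff]
      exact Cardinal.aleph0_lt_mk_iff.2 hN₀)
  obtain ⟨_, ⟨k, ⟨hkA, hkN⟩, rfl⟩, rfl⟩ := ha
  obtain ⟨b, ⟨β, hβ, rfl⟩, hab, hval⟩ := hτ fun _ _ _ => o (f k)
  have hlt : o k < β := hab _ (Finset.mem_singleton_self _) _ (Finset.mem_singleton_self _)
  have hv := hval 0 0
  simp only [Finset.orderEmbOfFin_singleton] at hv
  have hβ : N β = N₀ := hβ
  refine hN β k hkA (by rw [hβ]; exact not_lt.1 hkN) ?_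
  simp only [hg, dif_pos hlt]
  rw [hv, hdec]

/-- A nested sequence of codes of intervals. At step `k` the number `g k` is read as a finite
table that proposes a successor for each interval; the proposal is accepted if the interval
`[a e', b e']` lies in the present one and the code `e'` is at most `G (k + 1)`. -/
def nestedCode (a b : ℕ → ℚ) (dec : ℕ → (ℕ →₀ ℕ)) (e₀ : ℕ) (G g : ℕ → ℕ) : ℕ → ℕ
  | 0 => e₀
  | k + 1 =>
    if a (nestedCode a b dec e₀ G g k) ≤ a (dec (g k) (nestedCode a b dec e₀ G g k)) ∧
        a (dec (g k) (nestedCode a b dec e₀ G g k)) < b (dec (g k) (nestedCode a b dec e₀ G g k)) ∧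
        b (dec (g k) (nestedCode a b dec e₀ G g k)) ≤ b (nestedCode a b dec e₀ G g k) ∧
        dec (g k) (nestedCode a b dec e₀ G g k) ≤ G (k + 1)
    then dec (g k) (nestedCode a b dec e₀ G g k) else nestedCode a b dec e₀ G g k

section nestedCode

variable {a b : ℕ → ℚ} {dec : ℕ → (ℕ →₀ ℕ)} {e₀ : ℕ} {G g : ℕ → ℕ}

theorem nestedCode_le (hG : Monotone G) (h₀ : e₀ ≤ G 0) (k : ℕ) :
    nestedCode a b dec e₀ G g k ≤ G k := by
  induction k with
  | zero => exact h₀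
  | succ k ih =>
    rw [nestedCode]
    split_ifs with h
    · exact h.2.2.2
    · exact ih.trans (hG k.le_succ)

theorem nestedCode_lt (h₀ : a e₀ < b e₀) (k : ℕ) :
    a (nestedCode a b dec e₀ G g k) < b (nestedCode a b dec e₀ G g k) := by
  induction k with
  | zero => exact h₀
  | succ k ih =>
    rw [nestedCode]
    split_ifs with h
    · exact h.2.1
    · exact ih

theorem exists_mem_nestedCode (h₀ : a e₀ < b e₀) :
    ∃ y : ℝ, ∀ k, y ∈ Set.Icc (a (nestedCode a b dec e₀ G g k) : ℝ)
      (b (nestedCode a b dec e₀ G g k)) := by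
  have hanti : Antitone fun k => Set.Icc (a (nestedCode a b dec e₀ G g k) : ℝ)
      (b (nestedCode a b dec e₀ G g k)) := by
    refine antitone_nat_of_succ_le fun k => ?_
    rw [nestedCode]
    split_ifs with h
    · exact Set.Icc_subset_Icc (by exact_mod_cast h.1) (by exact_mod_cast h.2.2.1)
    · exact le_rfl
  have := ciSup_mem_iInter_Icc_of_antitone_Icc hanti
    (fun k => by exact_mod_cast (nestedCode_lt h₀ k).le)
  exact ⟨_, Set.mem_iInter.1 this⟩

end nestedCode

/-- The increasing function, with values above `e₀`, that bounds the codes of the nested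
intervals. -/
def partialSum (e₀ : ℕ) (g : ℕ → ℕ) (k : ℕ) : ℕ := e₀ + k + 1 + ∑ i ∈ Finset.range (k + 1), g i

theorem partialSum_mono (e₀ : ℕ) (g : ℕ → ℕ) : Monotone (partialSum e₀ g) := by
  refine monotone_nat_of_le_succ fun k => ?_
  rw [partialSum, partialSum, Finset.sum_range_succ _ (k + 1)]
  omega

theorem lt_partialSum (e₀ : ℕ) (g : ℕ → ℕ) (k : ℕ) : g k < partialSum e₀ g k := by
  rw [partialSum, Finset.sum_range_succ]
  omega

/-- If `g` reaches the iterates of a monotone `h` infinitely often, then its partial sums jump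
by at least `h` infinitely often: otherwise they are eventually bounded by the iterates. -/
theorem infinite_setOf_le_partialSum_succ {h : ℕ → ℕ} (hm : Monotone h) (hle : ∀ v, v ≤ h v)
    (e₀ : ℕ) {g : ℕ → ℕ} (hg : {k | g k = h^[k] k}.Infinite) :
    {k | h (partialSum e₀ g k) ≤ partialSum e₀ g (k + 1)}.Infinite := by
  intro hfin
  obtain ⟨K, hK⟩ := hfin.bddAbove
  have hlt : ∀ k, K < k → partialSum e₀ g (k + 1) < h (partialSum e₀ g k) := by
    intro k hk
    by_contra! hcon
    exact absurd (hK hcon) (not_le.2 hk)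
  have hiter : ∀ i, partialSum e₀ g (K + 1 + i) ≤ h^[i] (partialSum e₀ g (K + 1)) := by
    intro i
    induction i with
    | zero => exact le_rfl
    | succ i ih =>
      rw [Function.iterate_succ_apply', ← add_assoc]
      exact (hlt _ (by omega)).le.trans (hm ih)
  obtain ⟨k, hk, hkK⟩ := hg.exists_gt (K + 1 + partialSum e₀ g (K + 1))
  obtain ⟨i, rfl⟩ : ∃ i, k = K + 1 + i := ⟨k - (K + 1), by omega⟩
  have h1 : g (K + 1 + i) = h^[K + 1 + i] (K + 1 + i) := hk
  have h2 := lt_partialSum e₀ g (K + 1 + i)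
  have h3 := (hiter i).trans ((hm.iterate i) (show partialSum e₀ g (K + 1) ≤ K + 1 + i by omega))
  have h4 : h^[i] (K + 1 + i) ≤ h^[K + 1 + i] (K + 1 + i) :=
    Function.monotone_iterate_of_id_le hle (by omega : i ≤ K + 1 + i) _
  omega

theorem exists_antitone_dense_open_of_mem_residual {s : Set ℝ} (hs : s ∈ residual ℝ) :
    ∃ U : ℕ → Set ℝ, (∀ k, IsOpen (U k)) ∧ (∀ k, Dense (U k)) ∧ Antitone U ∧ ⋂ k, U k ⊆ s := by
  obtain ⟨C, hCo, hCd, hCc, hCs⟩ := mem_residual_iff.1 hs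
  obtain ⟨f, hf⟩ := (hCc.insert Set.univ).exists_eq_range ⟨_, Set.mem_insert _ _⟩
  have hfo : ∀ k, IsOpen (f k) ∧ Dense (f k) := by
    intro k
    rcases (hf ▸ Set.mem_range_self k : f k ∈ insert Set.univ C) with h | h
    · rw [h]; exact ⟨isOpen_univ, dense_univ⟩
    · exact ⟨hCo _ h, hCd _ h⟩
  let U : ℕ → Set ℝ := fun k => Nat.rec (f 0) (fun i V => V ∩ f (i + 1)) k
  have hU : ∀ k, IsOpen (U k) ∧ Dense (U k) := by
    intro k
    induction k with
    | zero => exact hfo 0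
    | succ k ih =>
      exact ⟨ih.1.inter (hfo _).1, ih.2.inter_of_isOpen_left (hfo _).2 ih.1⟩
  have hUf : ∀ k, U k ⊆ f k := by
    rintro (_ | k)
    · exact subset_rfl
    · exact Set.inter_subset_right
  refine ⟨U, fun k => (hU k).1, fun k => (hU k).2,
    antitone_nat_of_succ_le fun k => Set.inter_subset_left, fun x hx => hCs ?_⟩
  intro t ht
  obtain ⟨k, rfl⟩ : t ∈ Set.range f := hf ▸ Set.mem_insert_of_mem _ ht
  exact hUf k (Set.mem_iInter.1 hx k)

theorem exists_rat_Icc_subset {U : Set ℝ} (hU : IsOpen U) (hd : Dense U) {a b : ℚ} (hab : a < b) :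
    ∃ a' b' : ℚ, a ≤ a' ∧ a' < b' ∧ b' ≤ b ∧ Set.Icc (a' : ℝ) b' ⊆ U := by
  obtain ⟨x, hx, hxU⟩ := hd.inter_open_nonempty (Set.Ioo (a : ℝ) b) isOpen_Ioo
    (Set.nonempty_Ioo.2 (by exact_mod_cast hab))
  obtain ⟨l, u, ⟨hl, hu⟩, hsub⟩ := mem_nhds_iff_exists_Ioo_subset.1
    ((isOpen_Ioo.inter hU).mem_nhds ⟨hx, hxU⟩)
  obtain ⟨a', ha1, ha2⟩ := exists_rat_btwn hl
  obtain ⟨b', hb1, hb2⟩ := exists_rat_btwn hu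
  have hlt : (a' : ℝ) < b' := ha2.trans hb1
  have hsub' : Set.Icc (a' : ℝ) b' ⊆ Set.Ioo (a : ℝ) b ∩ U := fun y hy =>
    hsub ⟨ha1.trans_le hy.1, hy.2.trans_lt hb2⟩
  refine ⟨a', b', ?_, by exact_mod_cast hlt, ?_, fun y hy => (hsub' hy).2⟩
  · exact_mod_cast (hsub' (Set.left_mem_Icc.2 hlt.le)).1.1.le
  · exact_mod_cast (hsub' (Set.right_mem_Icc.2 hlt.le)).1.2.le

/-- The nonmeager set consists of points of nested sequences of intervals, one for each pair of
members of the family: the first member provides the bounds on the codes that keep the possible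
intervals at each step finite in number, and the second proposes the intervals. -/
theorem nonMeager_eq_aleph_one_of_family {g : OmegaOne → ℕ → ℕ}
    (hg : ∀ (A : Set ℕ) (f : ℕ → ℕ), A.Infinite → ∃ β, {k ∈ A | g β k = f k}.Infinite) :
    nonMeager = ℵ₁ := by
  classical
  obtain ⟨cd, hcd⟩ := exists_surjective_nat (ℚ × ℚ)
  obtain ⟨dec, hdec⟩ := exists_surjective_nat (ℕ →₀ ℕ)
  obtain ⟨e₀, he₀⟩ := hcd (0, 1)
  let a : ℕ → ℚ := fun e => (cd e).1
  let b : ℕ → ℚ := fun e => (cd e).2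
  have h₀ : a e₀ < b e₀ := by simp [a, b, he₀]
  choose Y hY using fun γ β => exists_mem_nestedCode (a := a) (b := b) (dec := dec)
    (G := partialSum e₀ (g γ)) (g := g β) h₀
  refine nonMeager_eq_aleph_one_iff.2
    ⟨Set.range fun q : OmegaOne × OmegaOne => Y q.1 q.2, fun hmeagre => ?_, ?_⟩
  swap
  · refine Cardinal.mk_range_le.trans ?_
    rw [Cardinal.mk_prod, Cardinal.lift_id, mk_omegaOne]
    exact (Cardinal.mul_eq_self Cardinal.aleph0_lt_aleph_one.le).le
  obtain ⟨U, hUo, hUd, hUa, hUs⟩ := exists_antitone_dense_open_of_mem_residual hmeagre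
  -- `next k e` codes a subinterval of the interval coded by `e` that lies in `U k`
  have hnext : ∀ k e, ∃ e', a e < b e →
      a e ≤ a e' ∧ a e' < b e' ∧ b e' ≤ b e ∧ Set.Icc (a e' : ℝ) (b e') ⊆ U k := by
    intro k e
    by_cases h : a e < b e
    · obtain ⟨a', b', h'⟩ := exists_rat_Icc_subset (hUo k) (hUd k) h
      obtain ⟨e', he'⟩ := hcd (a', b')
      exact ⟨e', fun _ => by simpa only [a, b, he'] using h'⟩
    · exact ⟨0, fun h' => absurd h' h⟩
  choose next hnext using hnext
  -- a monotone bound for the codes needed next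
  let h : ℕ → ℕ := fun v =>
    v + ∑ k ∈ Finset.range (v + 1), ∑ e ∈ Finset.range (v + 1), next k e
  have hm : Monotone h := by
    intro v w hvw
    refine Nat.add_le_add hvw ?_
    have hsub : Finset.range (v + 1) ⊆ Finset.range (w + 1) :=
      Finset.range_subset_range.2 (by omega)
    exact (Finset.sum_le_sum fun k _ => Finset.sum_le_sum_of_subset hsub).trans
      (Finset.sum_le_sum_of_subset hsub)
  have hnext_le : ∀ v k e, k ≤ v → e ≤ v → next k e ≤ h v := by
    intro v k e hk he
    refine le_trans ?_ (Nat.le_add_left _ _)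
    refine le_trans ?_ (Finset.single_le_sum (f := fun k => ∑ e ∈ Finset.range (v + 1), next k e)
      (fun _ _ => Nat.zero_le _) (Finset.mem_range.2 (Nat.lt_succ_of_le hk)))
    exact Finset.single_le_sum (f := fun e => next k e)
      (fun _ _ => Nat.zero_le _) (Finset.mem_range.2 (Nat.lt_succ_of_le he))
  obtain ⟨γ, hγ⟩ := hg Set.univ (fun k => h^[k] k) Set.infinite_univ
  set G := partialSum e₀ (g γ) with hG
  have hA : {k | h (G k) ≤ G (k + 1)}.Infinite :=
    infinite_setOf_le_partialSum_succ hm (fun v => Nat.le_add_right _ _) e₀ (by simpa using hγ)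
  choose φ hφ using fun k => exists_finsupp_eq_on (next k) (Finset.range (G k + 1))
  choose f hf using fun k => hdec (φ k)
  obtain ⟨β, hβ⟩ := hg _ f hA
  have hfreq : ∀ k, h (G k) ≤ G (k + 1) → g β k = f k → Y γ β ∈ U k := by
    intro k hk hgk
    set e := nestedCode a b dec e₀ G (g β) k with he
    have heG : e ≤ G k := nestedCode_le (partialSum_mono _ _) (by simp [partialSum]; omega) k
    have hkG : k ≤ G k := by simp only [hG, partialSum]; omega
    have hd : dec (g β k) e = next k e := by
      rw [hgk, hf, hφ k e (Finset.mem_range.2 (Nat.lt_succ_of_le heG))]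
    obtain ⟨h1, h2, h3, h4⟩ := hnext k e (nestedCode_lt h₀ k)
    have hstep : nestedCode a b dec e₀ G (g β) (k + 1) = next k e := by
      rw [nestedCode, ← he, hd, if_pos ⟨h1, h2, h3, (hnext_le _ k e hkG heG).trans hk⟩]
    have := hY γ β (k + 1)
    rw [← hG, hstep] at this
    exact h4 this
  refine hUs (Set.mem_iInter.2 fun i => ?_) ⟨(γ, β), rfl⟩
  obtain ⟨k, ⟨hk1, hk2⟩, hik⟩ := hβ.exists_gt i
  exact hUa hik.le (hfreq k hk1 hk2)

theorem isLInftyCoherent_zero : IsLInftyCoherent fun _ => 0 := by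
  intro β β' hβ
  refine (Set.finite_singleton (0 : ℤ)).subset ?_
  rintro z ⟨α, hα, rfl⟩
  simp [pairValue]

theorem corollary3p2 :
    nonMeager = ℵ₁ ↔
      ∀ p : OmegaOnePairs → ℕ, IsLInftyCoherent p → PrZero OmegaOne ℵ₀ p := by
  refine ⟨fun h p hp => prZero_of_nonMeager_eq_aleph_one h hp, fun h => ?_⟩
  obtain ⟨g, hg⟩ := exists_infinitely_often_equal_family (h _ isLInftyCoherent_zero)
  exact nonMeager_eq_aleph_one_of_family hg
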